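/- Let $(R,\mathfrak m)$ be a Noetherian local ring of dimension $d\ge 1$, let $I$ be an $\mathfrak m$-primary ideal, and let $\mathcal I=\{I_n\}_{n\in\mathbb Z}$ be an $I$-admissible filtration, i.e. a family of ideals for which there is $k\in\mathbb N$ such that for all $m,n\in\mathbb Z$ $$I_{n+1}\subseteq I_n,\qquad I_mI_n\subseteq I_{n+m},\qquad I^n\subseteq I_n\subseteq I^{n-k}$$ (where $I^r=R$ for $r\le 0$). A reduction of $\mathcal I$ is an ideal $J\subseteq I_1$ with $JI_n=I_{n+1}$ for all large $n$; a minimal reduction is a reduction that is minimal with respect to containment. Let $x=x_1,\dots,x_d$ be elements of $R$ such that the ideal $(x_1,\dots,x_d)$ is a minimal reduction of $\mathcal I$. For $n\in\mathbb Z$ let $K^{(n)}(x,\mathcal I)$ be the subcomplex $$0\to I_{n-d}\to (I_{n-d+1})^{\binom{d}{1}}\to\cdots\to (I_{n-1})^{\binom{d}{d-1}}\to I_n\to 0$$ of the Koszul complex of $x_1,\dots,x_d$ on $R$, whose term in homological degree $i$ is the sum of $\binom di$ copies of $I_{n-i}$. Let $\lambda$ denote length of $R$-modules. Then all $R/I_n$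 and all $H_i(K^{(n)}(x,\mathcal I))$ have finite length, there are unique integers $e_0(\mathcal I),\dots,e_d(\mathcal I)$ (the Hilbert coefficients of $\mathcal I$) such that $$\lambda(R/I_n)=\sum_{i=0}^{d}(-1)^i e_i(\mathcal I)\binom{n+d-i-1}{d-i}\quad\text{for all large } n,$$ and, with $\chi(K^{(n)}(x,\mathcal I))=\sum_{i=0}^d(-1)^i\lambda\bigl(H_i(K^{(n)}(x,\mathcal I))\bigr)$, only finitely many of the integers $\chi(K^{(n)}(x,\mathcal I))$, $n\ge 1$, are nonzero and the Chern number $e_1(\mathcal I)$ is $$e_1(\mathcal I)=\sum_{n=1}^{\infty}\chi\bigl(K^{(n)}(x,\mathcal I)\bigr).$$ -/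

import Mathlib

namespace ChernNumber

noncomputable section

universe u

variable {R : Type u} [CommRing R]

/-- `F = {I_n}` (indexed by `ℤ`) is an `I`-admissible filtration: there is `k : ℕ` such that
`I_{n+1} ⊆ I_n`, `I_m I_n ⊆ I_{n+m}` and `I^n ⊆ I_n ⊆ I^{n-k}` for all integers `m, n`.
As usual a power of an ideal with exponent `≤ 0` is the unit ideal, which is what `Int.toNat`
in the exponents expresses. -/
def IsAdmissible (I : Ideal R) (F : ℤ → Ideal R) : Prop :=
  ∃ k : ℕ, ∀ n m : ℤ,
    F (n + 1) ≤ F n ∧ F m * F n ≤ F (n + m) ∧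
      I ^ n.toNat ≤ F n ∧ F n ≤ I ^ (n - (k : ℤ)).toNat

/-- `J` is a reduction of `F`: `J ⊆ I_1` and `J I_n = I_{n+1}` for all large `n`. -/
def IsReduction (F : ℤ → Ideal R) (J : Ideal R) : Prop :=
  J ≤ F 1 ∧ ∃ n₀ : ℤ, ∀ n : ℤ, n₀ ≤ n → J * F n = F (n + 1)

/-- A minimal reduction: a reduction that is minimal with respect to containment. -/
def IsMinimalReduction (F : ℤ → Ideal R) (J : Ideal R) : Prop :=
  Minimal (IsReduction F) J

/-- The Hilbert function `H(n) = λ(R / I_n)`. -/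
def hilbertFunction (F : ℤ → Ideal R) (n : ℤ) : ℕ :=
  (Module.length R (R ⧸ F n)).toNat

/-- The polynomial `binom(X + m - 1, m) = X (X + 1) ⋯ (X + m - 1) / m!` in `ℚ[X]`. -/
def binomPoly (m : ℕ) : Polynomial ℚ :=
  Polynomial.C ((m.factorial : ℚ)⁻¹) * ascPochhammer ℚ m

/-- The polynomial `∑_{i = 0}^{d} (-1)^i e_i binom(X + d - i - 1, d - i)`. -/
def polyOfCoefficients (d : ℕ) (e : Fin (d + 1) → ℤ) : Polynomial ℚ :=
  ∑ i : Fin (d + 1),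
    Polynomial.C ((-1 : ℚ) ^ (i : ℕ) * (e i : ℚ)) * binomPoly (d - (i : ℕ))

/-- The integers `e_0, …, e_d` are the Hilbert coefficients of `F` (in dimension `d`):
`H(n) = ∑_i (-1)^i e_i binom(n + d - i - 1, d - i)` for all large `n`.
The Chern number is `e 1`. -/
def IsHilbertCoefficients (d : ℕ) (F : ℤ → Ideal R) (e : Fin (d + 1) → ℤ) : Prop :=
  ∃ n₀ : ℤ, ∀ n : ℤ, n₀ ≤ n →
    (hilbertFunction F n : ℚ) = (polyOfCoefficients d e).eval (n : ℚ)

/-- The sign `(-1)^{#{k ∈ T : k < j}}`. -/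
def koszulSign {d : ℕ} (T : Finset (Fin d)) (j : Fin d) : R :=
  (-1) ^ (T.filter (fun k => k < j)).card

/-- The Koszul differential of `x_1, …, x_d` on the total module `⨁_S R e_S` with basis the
`e_S = e_{s_1} ∧ ⋯ ∧ e_{s_i}` for `S = {s_1 < ⋯ < s_i}`; an element `∑_S a_S e_S` is the function
`S ↦ a_S`, and `∂ e_S = ∑_{p = 1}^{i} (-1)^{p-1} x_{s_p} e_{S ∖ {s_p}}`. The `T`-coordinate of
`∂ a` is therefore the sum of `± x_j a_{T ∪ {j}}` over the `j` not in `T`. -/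
def koszulDiff {d : ℕ} (x : Fin d → R) : (Finset (Fin d) → R) →ₗ[R] (Finset (Fin d) → R) where
  toFun a T := ∑ j ∈ Tᶜ, koszulSign T j * x j * a (insert j T)
  map_add' a b := by
    funext T
    simp only [Pi.add_apply, mul_add, Finset.sum_add_distrib]
  map_smul' r a := by
    funext T
    simp only [Pi.smul_apply, smul_eq_mul, RingHom.id_apply, Finset.mul_sum]
    exact Finset.sum_congr rfl fun j _ => by ring

/-- The term of homological degree `i` of the complex `K^{(n)}(x, F)`, the direct sum of
`binom(d, i)` copies of `I_{n-i}` inside the degree `i` part `⨁_{|S| = i} R e_S` of the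
Koszul complex. -/
def koszulTerm (d : ℕ) (F : ℤ → Ideal R) (n : ℤ) (i : ℕ) : Submodule R (Finset (Fin d) → R) where
  carrier := {a | ∀ S : Finset (Fin d),
    (S.card = i → a S ∈ F (n - (i : ℤ))) ∧ (S.card ≠ i → a S = 0)}
  add_mem' {a b} ha hb S :=
    ⟨fun h => (F _).add_mem ((ha S).1 h) ((hb S).1 h), fun h => by
      rw [Pi.add_apply, (ha S).2 h, (hb S).2 h, add_zero]⟩
  zero_mem' S := ⟨fun _ => (F _).zero_mem, fun _ => rfl⟩
  smul_mem' r a ha S :=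
    ⟨fun h => (F _).mul_mem_left r ((ha S).1 h), fun h => by
      rw [Pi.smul_apply, (ha S).2 h, smul_zero]⟩

/-- The cycles of degree `i` of `K^{(n)}(x, F)`. -/
def koszulCycles {d : ℕ} (x : Fin d → R) (F : ℤ → Ideal R) (n : ℤ) (i : ℕ) :
    Submodule R (Finset (Fin d) → R) :=
  koszulTerm d F n i ⊓ LinearMap.ker (koszulDiff x)

/-- The boundaries of degree `i` of `K^{(n)}(x, F)`. -/
def koszulBoundaries {d : ℕ} (x : Fin d → R) (F : ℤ → Ideal R) (n : ℤ) (i : ℕ) :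
    Submodule R (Finset (Fin d) → R) :=
  (koszulTerm d F n (i + 1)).map (koszulDiff x)

theorem koszulDiff_comp_self {d : ℕ} (x : Fin d → R) (a : Finset (Fin d) → R) :
    koszulDiff x (koszulDiff x a) = 0 := by
  funext T
  change ∑ j ∈ Tᶜ, koszulSign T j * x j *
    (∑ l ∈ (insert j T)ᶜ, koszulSign (insert j T) l * x l * a (insert l (insert j T))) = 0
  simp only [Finset.mul_sum]
  rw [Finset.sum_sigma']
  have key : ∀ j l : Fin d, j ∉ T → l ∉ T → j < l →
      (koszulSign T j : R) * koszulSign (insert j T) l =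
        - (koszulSign T l * koszulSign (insert l T) j) := by
    intro j l hj hl h
    unfold koszulSign
    rw [Finset.filter_insert, Finset.filter_insert, if_pos h, if_neg (not_lt.2 h.le),
      Finset.card_insert_of_notMem (by simp [hj])]
    ring
  refine Finset.sum_involution (fun p _ => ⟨p.2, p.1⟩) ?_ ?_ ?_ ?_
  · rintro ⟨j, l⟩ h
    simp only [Finset.mem_sigma, Finset.mem_compl, Finset.mem_insert, not_or] at h
    obtain ⟨hj, hlj, hl⟩ := h
    simp only [Finset.insert_comm j l T]
    rcases lt_or_gt_of_ne hlj with h | h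
    · linear_combination (x j * x l * a (insert l (insert j T))) * key l j hl hj h
    · linear_combination (x j * x l * a (insert l (insert j T))) * key j l hj hl h
  · rintro ⟨j, l⟩ h _ h2
    simp only [Finset.mem_sigma, Finset.mem_compl, Finset.mem_insert, not_or] at h
    exact h.2.1 (congrArg Sigma.fst h2)
  · rintro ⟨j, l⟩ h
    simp only [Finset.mem_sigma, Finset.mem_compl, Finset.mem_insert, not_or] at h ⊢
    exact ⟨h.2.2, fun h' => h.2.1 h'.symm, h.1⟩
  · rintro ⟨j, l⟩ h
    rfl

/-- The Koszul differential maps the term of degree `i + 1` of `K^{(n)}(x, F)` to the term of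
degree `i` when the `x_j` lie in `I_1`, so `K^{(n)}(x, F)` is a subcomplex. -/
theorem koszulDiff_mem {d : ℕ} {x : Fin d → R} {I : Ideal R} {F : ℤ → Ideal R}
    (hF : IsAdmissible I F) (hx : ∀ j, x j ∈ F 1) (n : ℤ) (i : ℕ) {a : Finset (Fin d) → R}
    (ha : a ∈ koszulTerm d F n (i + 1)) : koszulDiff x a ∈ koszulTerm d F n i := by
  obtain ⟨k, hk⟩ := hF
  intro T
  have hc : ∀ j ∈ Tᶜ, (insert j T).card = T.card + 1 := fun j hj =>
    Finset.card_insert_of_notMem (Finset.mem_compl.1 hj)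
  refine ⟨fun h => Ideal.sum_mem _ fun j hj => ?_, fun h => Finset.sum_eq_zero fun j hj => ?_⟩
  · have h1 := (ha (insert j T)).1 (by rw [hc j hj, h])
    have h2 := (hk (n - ((i + 1 : ℕ) : ℤ)) 1).2.1 (Ideal.mul_mem_mul (hx j) h1)
    rw [mul_assoc]
    refine Ideal.mul_mem_left _ _ ?_
    convert h2 using 2
    push_cast
    ring
  · rw [(ha (insert j T)).2 (by rw [hc j hj]; omega), mul_zero]

theorem koszulBoundaries_le_koszulCycles {d : ℕ} {x : Fin d → R} {I : Ideal R}
    {F : ℤ → Ideal R} (hF : IsAdmissible I F) (hx : ∀ j, x j ∈ F 1) (n : ℤ) (i : ℕ) :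
    koszulBoundaries x F n i ≤ koszulCycles x F n i := by
  rintro _ ⟨a, ha, rfl⟩
  exact ⟨koszulDiff_mem hF hx n i ha, koszulDiff_comp_self x a⟩

/-- The homology module `H_i(K^{(n)}(x, F))`, cycles modulo boundaries. (On the term of degree
`0` the differential vanishes, and the term of degree `d + 1` is zero.) -/
abbrev koszulHomology {d : ℕ} (x : Fin d → R) (F : ℤ → Ideal R) (n : ℤ) (i : ℕ) : Type u :=
  koszulCycles x F n i ⧸ (koszulBoundaries x F n i).submoduleOf (koszulCycles x F n i)

/-- The Euler characteristic `χ(K^{(n)}(x, F)) = ∑_{i = 0}^{d} (-1)^i λ(H_i(K^{(n)}(x, F)))`. -/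
def eulerChar {d : ℕ} (x : Fin d → R) (F : ℤ → Ideal R) (n : ℤ) : ℤ :=
  ∑ i ∈ Finset.range (d + 1),
    (-1) ^ i * ((Module.length R (koszulHomology x F n i)).toNat : ℤ)

end

end ChernNumber

/-!
The Euler characteristics of the complexes `K^{(n)} = K^{(n)}(x, F)` are controlled by three facts.

* The exterior multiplication `e_j ∧ ·` maps `K^{(n)}` to `K^{(n+1)}`, raising the homological
  degree by one, and is a homotopy between multiplication by `x_j` and zero
  (`koszulDiff_koszulWedge_add`). Hence `J = (x_1, …, x_d)` kills the homology of `K^{(n)}`, which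
  therefore has finite length (`length_koszulHomology_ne_top`), and `J Z_i(K^{(n)})` lies in
  `B_i(K^{(n+1)})`.
* As `J` is a reduction, the terms of fixed homological degree form a stable `J`-filtration; by the
  Artin–Rees lemma so do the cycles, so `Z_i(K^{(n+1)}) = J Z_i(K^{(n)})` for large `n`. With the
  preceding inclusion, `K^{(n)}` is exact for large `n` (`exists_eulerChar_eq_zero`).
* The quotient `K^{(0)} / K^{(n)}` has terms `(R / I_{n-i})^{binom(d, i)}`, so additivity of length
  gives `∑_i (-1)^i binom(d, i) λ(R / I_{n-i}) = χ(K^{(0)}) - χ(K^{(n)})` for `n ≥ 0`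
  (`sum_choose_mul_hilbertFunction`).

The left-hand side of the last formula is the `d`-th backward difference of the Hilbert function
`H`, so this difference is eventually constant. That yields the Hilbert coefficients, with
`e_0 = χ(K^{(0)})`; no separate theorem identifying the Koszul multiplicity is needed. Summing
`e_0 - ∇^d H(n)` over `1 ≤ n ≤ N` telescopes to `N e_0 - ∇^{d-1} H(N)`, because `H` vanishes on
the integers `≤ 0`, and `∇^{d-1} H(N) = e_0 N - e_1` for large `N`.
-/

namespace ChernNumber

/-! ### Relative lengths of submodules -/

section RelLength

variable {R : Type*} [CommRing R]

/-- Additivity of length for `0 → K ⧸ p → N ⧸ q → P ⧸ r → 0`, exactness being expressed by the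
submodules `p`, `q`, `r`. -/
theorem length_quotient_eq_add {K N P : Type*} [AddCommGroup K] [AddCommGroup N]
    [AddCommGroup P] [Module R K] [Module R N] [Module R P] (f : K →ₗ[R] N) (g : N →ₗ[R] P)
    {p : Submodule R K} {q : Submodule R N} {r : Submodule R P}
    (hp : p = q.comap f) (hr : r.comap g = q ⊔ LinearMap.range f)
    (hg : Function.Surjective g) :
    Module.length R (N ⧸ q) = Module.length R (K ⧸ p) + Module.length R (P ⧸ r) := by
  have hqr : q ≤ r.comap g := hr ▸ le_sup_left
  refine Module.length_eq_add_of_exact (p.mapQ q f hp.le) (q.mapQ r g hqr) ?_ ?_ ?_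
  · rw [← LinearMap.ker_eq_bot, Submodule.mapQ, Submodule.ker_liftQ_eq_bot]
    rw [LinearMap.ker_comp, Submodule.ker_mkQ, hp]
  · rintro ⟨y⟩
    obtain ⟨z, rfl⟩ := hg y
    exact ⟨q.mkQ z, rfl⟩
  · rintro ⟨y⟩
    change r.mkQ (g y) = 0 ↔ _
    rw [Submodule.mkQ_apply, Submodule.Quotient.mk_eq_zero, ← Submodule.mem_comap, hr,
      Submodule.mem_sup]
    constructor
    · rintro ⟨a, ha, _, ⟨b, rfl⟩, rfl⟩
      refine ⟨p.mkQ b, (Submodule.Quotient.eq q).2 ?_⟩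
      simpa using ha
    · rintro ⟨⟨b⟩, hb⟩
      refine ⟨y - f b, ?_, f b, ⟨b, rfl⟩, by simp⟩
      exact (Submodule.Quotient.eq q).1 hb.symm

variable {M M' : Type*} [AddCommGroup M] [Module R M] [AddCommGroup M'] [Module R M']

/-- The length of `B / (A ∩ B)` for submodules `A`, `B` of a module; it is used for `A ≤ B`. -/
noncomputable def relLength (A B : Submodule R M) : ℕ∞ :=
  Module.length R (B ⧸ A.submoduleOf B)

theorem relLength_add {A B C : Submodule R M} (hAB : A ≤ B) (hBC : B ≤ C) :
    relLength A C = relLength A B + relLength B C := by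
  refine length_quotient_eq_add (Submodule.inclusion hBC) LinearMap.id ?_ ?_
    Function.surjective_id
  · ext; rfl
  · ext ⟨y, hy⟩
    simp only [Submodule.comap_id, Submodule.range_inclusion]
    rw [← Submodule.submoduleOf, sup_eq_right.2 (Submodule.comap_mono hAB)]

/-- A linear map splits the length of `B / A` into the contributions of kernel and image. -/
theorem relLength_eq_ker_add_map (f : M →ₗ[R] M') {A B : Submodule R M} (hAB : A ≤ B) :
    relLength A B =
      relLength (A ⊓ LinearMap.ker f) (B ⊓ LinearMap.ker f) +
        relLength (A.map f) (B.map f) := by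
  refine length_quotient_eq_add (Submodule.inclusion inf_le_left)
    (f.submoduleMap B) ?_ ?_ (f.submoduleMap_surjective B)
  · ext ⟨y, hy⟩
    exact ⟨fun h => h.1, fun h => ⟨h, hy.2⟩⟩
  · ext ⟨y, hy⟩
    rw [Submodule.range_inclusion, Submodule.mem_sup]
    constructor
    · rintro ⟨a, ha, h⟩
      refine ⟨⟨a, hAB ha⟩, ha, ⟨y - a, B.sub_mem hy (hAB ha)⟩, ⟨B.sub_mem hy (hAB ha), ?_⟩,
        Subtype.ext (by simp)⟩
      change f (y - a) = 0
      rw [map_sub, h]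
      exact sub_self _
    · rintro ⟨⟨a, haB⟩, ha, ⟨b, hbB⟩, hb, h⟩
      refine ⟨a, ha, ?_⟩
      have : f b = 0 := hb.2
      have h' : a + b = y := congrArg Subtype.val h
      change f a = f y
      rw [← h', map_add, this, add_zero]

/-- Over a Noetherian local ring, a finitely generated module killed by a power of an ideal
primary to the maximal ideal has finite length. -/
theorem length_ne_top_of_pow_smul_eq_zero [IsLocalRing R] [IsNoetherianRing R] {I : Ideal R}
    (hI : I.radical = IsLocalRing.maximalIdeal R) (N : ℕ) [Module.Finite R M]
    (h : ∀ r ∈ I ^ N, ∀ m : M, r • m = 0) : Module.length R M ≠ ⊤ := by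
  have h' : ∀ r ∈ I ^ (N + 1), ∀ m : M, r • m = 0 := fun r hr =>
    h r (Ideal.pow_le_pow_right N.le_succ hr)
  have hrad : (I ^ (N + 1)).radical = IsLocalRing.maximalIdeal R := by
    rw [Ideal.radical_pow I N.succ_ne_zero, hI]
  have hmin : IsLocalRing.maximalIdeal R ∈ (I ^ (N + 1)).minimalPrimes := by
    refine ⟨⟨inferInstance, hrad ▸ Ideal.le_radical⟩, fun q hq _ => ?_⟩
    rw [← hrad]
    exact hq.1.radical_le_iff.2 hq.2
  have : IsArtinianRing (R ⧸ I ^ (N + 1)) :=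
    IsLocalRing.quotient_artinian_of_mem_minimalPrimes_of_isLocalRing _ hmin
  have htors : Module.IsTorsionBySet R M (I ^ (N + 1) : Ideal R) := fun m r => h' r r.2 m
  let _ : Module (R ⧸ I ^ (N + 1)) M := htors.module
  have : IsScalarTower R (R ⧸ I ^ (N + 1)) M := htors.isScalarTower
  have : Module.Finite (R ⧸ I ^ (N + 1)) M := Module.Finite.of_restrictScalars_finite R _ M
  rw [Module.length_eq_of_surjective (R := R ⧸ I ^ (N + 1)) Ideal.Quotient.mk_surjective]
  exact Module.length_ne_top

end RelLength

/-! ### The Koszul homotopy -/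

section Koszul

variable {R : Type*} [CommRing R] {d : ℕ}

theorem koszulSign_mul_self (T : Finset (Fin d)) (j : Fin d) :
    (koszulSign T j : R) * koszulSign T j = 1 := by
  rw [koszulSign, ← mul_pow, neg_one_mul, neg_neg, one_pow]

theorem koszulSign_mul_koszulSign_insert {T : Finset (Fin d)} {j l : Fin d} (hj : j ∉ T)
    (hl : l ∉ T) (h : j ≠ l) :
    (koszulSign T j : R) * koszulSign (insert j T) l =
      -(koszulSign T l * koszulSign (insert l T) j) := by
  have key : ∀ j l : Fin d, j ∉ T → j < l →
      (koszulSign T j : R) * koszulSign (insert j T) l =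
        -(koszulSign T l * koszulSign (insert l T) j) := by
    intro j l hj h
    unfold koszulSign
    rw [Finset.filter_insert, Finset.filter_insert, if_pos h, if_neg (not_lt.2 h.le),
      Finset.card_insert_of_notMem (by simp [hj])]
    ring
  rcases lt_or_gt_of_ne h with h | h
  · exact key j l hj h
  · rw [key l j hl h, neg_neg]

/-- Left exterior multiplication by the basis vector `e_j`, a homotopy on the Koszul complex
between multiplication by `x_j` and zero. -/
def koszulWedge (j : Fin d) (a : Finset (Fin d) → R) (S : Finset (Fin d)) : R :=
  if j ∈ S then koszulSign (S.erase j) j * a (S.erase j) else 0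

theorem koszulDiff_koszulWedge_add (x : Fin d → R) (j : Fin d) (a : Finset (Fin d) → R) :
    koszulDiff x (koszulWedge j a) + koszulWedge j (koszulDiff x a) = x j • a := by
  funext T
  change ∑ l ∈ Tᶜ, koszulSign T l * x l * koszulWedge j a (insert l T) +
    koszulWedge j (koszulDiff x a) T = x j * a T
  by_cases hj : j ∈ T
  · obtain ⟨U, hU, rfl⟩ : ∃ U, j ∉ U ∧ insert j U = T :=
      ⟨T.erase j, Finset.notMem_erase j T, Finset.insert_erase hj⟩
    rw [koszulWedge, if_pos hj, Finset.erase_insert hU]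
    change _ + koszulSign U j * (∑ l ∈ Uᶜ, koszulSign U l * x l * a (insert l U)) = _
    have hc : Uᶜ = insert j (insert j U)ᶜ := by
      ext l; by_cases h : l = j <;> simp [h, hU]
    rw [hc, Finset.sum_insert (by simp), mul_add, Finset.mul_sum, add_left_comm,
      ← Finset.sum_add_distrib]
    rw [Finset.sum_eq_zero, add_zero]
    · linear_combination (x j * a (insert j U)) * koszulSign_mul_self (R := R) U j
    · intro l hl
      simp only [Finset.mem_compl, Finset.mem_insert, not_or] at hl
      have h1 : j ∈ insert l (insert j U) := by simp
      have h2 : (insert l (insert j U)).erase j = insert l U := by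
        rw [Finset.insert_comm, Finset.erase_insert (by simp [hU, Ne.symm hl.1])]
      rw [koszulWedge, if_pos h1, h2]
      have e1 := koszulSign_mul_koszulSign_insert (R := R) hU hl.2 (Ne.symm hl.1)
      have e2 := koszulSign_mul_self (R := R) U j
      -- multiply the anticommutation relation of the signs by `sign (U, j) * sign (U, l)`
      linear_combination (x l * a (insert l U)) *
        (-(koszulSign (insert j U) l * koszulSign (insert l U) j) * e2 +
          koszulSign U j * koszulSign (insert l U) j * e1 +
          (-koszulSign U j * koszulSign U l) *
            koszulSign_mul_self (R := R) (insert l U) j)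
  · rw [koszulWedge, if_neg hj, add_zero, Finset.sum_eq_single_of_mem j (by simpa using hj)]
    · rw [koszulWedge, if_pos (by simp), Finset.erase_insert hj]
      linear_combination (x j * a T) * koszulSign_mul_self (R := R) T j
    · intro l _ hlj
      rw [koszulWedge, if_neg (by simp [hj, Ne.symm hlj]), mul_zero]

theorem koszulWedge_mem {F : ℤ → Ideal R} {n : ℤ} {i : ℕ} (j : Fin d)
    {a : Finset (Fin d) → R} (ha : a ∈ koszulTerm d F n i) :
    koszulWedge j a ∈ koszulTerm d F (n + 1) (i + 1) := by
  intro S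
  by_cases hj : j ∈ S
  · have hc := Finset.card_erase_add_one hj
    rw [koszulWedge, if_pos hj]
    refine ⟨fun h => Ideal.mul_mem_left _ _ ?_, fun h => ?_⟩
    · convert (ha (S.erase j)).1 (by omega) using 2
      push_cast; ring
    · rw [(ha (S.erase j)).2 (by omega), mul_zero]
  · rw [koszulWedge, if_neg hj]
    exact ⟨fun _ => Ideal.zero_mem _, fun _ => rfl⟩

/-- The ideal generated by the `x_j` moves cycles of `K^{(n)}` to boundaries of `K^{(n+1)}`. -/
theorem span_smul_koszulCycles_le (x : Fin d → R) (F : ℤ → Ideal R) (n : ℤ) (i : ℕ) :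
    Ideal.span (Set.range x) • koszulCycles x F n i ≤ koszulBoundaries x F (n + 1) i := by
  refine Submodule.smul_le.2 fun r hr a ha => ?_
  suffices Ideal.span (Set.range x) ≤
      (koszulBoundaries x F (n + 1) i).comap (LinearMap.toSpanSingleton R _ a) from this hr
  rw [Ideal.span_le]
  rintro _ ⟨j, rfl⟩
  refine ⟨koszulWedge j a, koszulWedge_mem j ha.1, ?_⟩
  have h := koszulDiff_koszulWedge_add x j a
  have h0 : koszulDiff x a = 0 := ha.2
  have h1 : koszulWedge j (koszulDiff x a) = 0 := by
    rw [h0]; funext S; simp [koszulWedge]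
  rw [h1, add_zero] at h
  exact h

end Koszul

/-! ### Admissible filtrations and the subcomplexes they define -/

section Filtration

variable {R : Type*} [CommRing R] {d : ℕ} {I : Ideal R} {F : ℤ → Ideal R}

theorem IsAdmissible.antitone (hF : IsAdmissible I F) : Antitone F := by
  obtain ⟨k, hk⟩ := hF
  exact antitone_int_of_succ_le fun n => (hk n 0).1

theorem IsAdmissible.mul_le (hF : IsAdmissible I F) (m n : ℤ) : F m * F n ≤ F (n + m) := by
  obtain ⟨k, hk⟩ := hF
  exact (hk n m).2.1

theorem IsAdmissible.pow_le (hF : IsAdmissible I F) (n : ℤ) : I ^ n.toNat ≤ F n := by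
  obtain ⟨k, hk⟩ := hF
  exact (hk n 0).2.2.1

theorem IsAdmissible.eq_top (hF : IsAdmissible I F) {n : ℤ} (hn : n ≤ 0) : F n = ⊤ := by
  have := hF.pow_le n
  rwa [Int.toNat_of_nonpos hn, pow_zero, Ideal.one_eq_top, top_le_iff] at this

theorem IsAdmissible.hilbertFunction_eq_zero (hF : IsAdmissible I F) {n : ℤ} (hn : n ≤ 0) :
    hilbertFunction F n = 0 := by
  rw [hilbertFunction, hF.eq_top hn, Module.length_eq_zero, ENat.toNat_zero]

theorem IsAdmissible.length_quotient_ne_top [IsLocalRing R] [IsNoetherianRing R]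
    (hF : IsAdmissible I F) (hI : I.radical = IsLocalRing.maximalIdeal R) (n : ℤ) :
    Module.length R (R ⧸ F n) ≠ ⊤ := by
  refine length_ne_top_of_pow_smul_eq_zero hI n.toNat fun r hr => ?_
  rintro ⟨m⟩
  exact (Submodule.Quotient.mk_eq_zero (F n)).2 ((F n).mul_mem_right m (hF.pow_le n hr))

/-- A reduction contains a power of the ideal of the admissible filtration. -/
theorem IsReduction.exists_pow_le (hF : IsAdmissible I F) {J : Ideal R} (hJ : IsReduction F J) :
    ∃ N : ℕ, I ^ N ≤ J := by
  obtain ⟨-, n₀, h⟩ := hJ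
  exact ⟨(n₀ + 1).toNat, (hF.pow_le _).trans ((h n₀ le_rfl).ge.trans Ideal.mul_le_left)⟩

theorem koszulTerm_antitone (hF : IsAdmissible I F) (i : ℕ) :
    Antitone fun n => koszulTerm d F n i := fun _ _ hmn _ ha S =>
  ⟨fun h => hF.antitone (by omega) ((ha S).1 h), (ha S).2⟩

theorem koszulCycles_antitone (hF : IsAdmissible I F) (x : Fin d → R) (i : ℕ) :
    Antitone fun n => koszulCycles x F n i := fun _ _ hmn =>
  inf_le_inf_right _ (koszulTerm_antitone hF i hmn)

theorem koszulBoundaries_antitone (hF : IsAdmissible I F) (x : Fin d → R) (i : ℕ) :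
    Antitone fun n => koszulBoundaries x F n i := fun _ _ hmn =>
  Submodule.map_mono (koszulTerm_antitone hF (i + 1) hmn)

theorem mem_filtration_one {x : Fin d → R} (hx : IsReduction F (Ideal.span (Set.range x)))
    (j : Fin d) : x j ∈ F 1 :=
  hx.1 (Ideal.subset_span ⟨j, rfl⟩)

theorem length_koszulHomology_ne_top [IsLocalRing R] [IsNoetherianRing R]
    (hF : IsAdmissible I F) (hI : I.radical = IsLocalRing.maximalIdeal R) {x : Fin d → R}
    (hx : IsReduction F (Ideal.span (Set.range x))) (n : ℤ) (i : ℕ) :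
    Module.length R (koszulHomology x F n i) ≠ ⊤ := by
  obtain ⟨N, hN⟩ := hx.exists_pow_le hF
  refine length_ne_top_of_pow_smul_eq_zero hI N fun r hr => ?_
  rintro ⟨a⟩
  exact (Submodule.Quotient.mk_eq_zero _).2 (koszulBoundaries_antitone hF x i (by simp)
    (span_smul_koszulCycles_le x F n i (Submodule.smul_mem_smul (hN hr) a.2)))

/-! ### Vanishing of the homology in large degrees -/

theorem smul_koszulTerm_le (hF : IsAdmissible I F) {J : Ideal R} (hJ : J ≤ F 1) (n : ℤ)
    (i : ℕ) : J • koszulTerm d F n i ≤ koszulTerm d F (n + 1) i := by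
  refine Submodule.smul_le.2 fun r hr a ha S => ⟨fun h => ?_, fun h => ?_⟩
  · convert hF.mul_le _ _ (Ideal.mul_mem_mul (hJ hr) ((ha S).1 h)) using 2
    · ring
    · rfl
  · rw [Pi.smul_apply, (ha S).2 h, smul_zero]

theorem koszulTerm_succ_le_smul {J : Ideal R} {n : ℤ} {i : ℕ}
    (h : J * F (n - i) = F (n - i + 1)) : koszulTerm d F (n + 1) i ≤ J • koszulTerm d F n i := by
  classical
  intro a ha
  rw [← Finset.univ_sum_single a]
  refine Submodule.sum_mem _ fun S _ => ?_
  by_cases hS : S.card = i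
  · have h1 : a S ∈ J • F (n - i) := by
      rw [smul_eq_mul, h]
      convert (ha S).1 hS using 2
      ring
    have h2 := Submodule.mem_map_of_mem (f := LinearMap.single R (fun _ => R) S) h1
    rw [Submodule.map_smul''] at h2
    refine SetLike.le_def.1 (smul_mono_right J ?_) h2
    rintro _ ⟨b, hb, rfl⟩ T
    rw [LinearMap.single_apply]
    rcases eq_or_ne T S with rfl | hT
    · rw [Pi.single_eq_same]
      exact ⟨fun _ => hb, fun h => absurd hS h⟩
    · rw [Pi.single_eq_of_ne hT]
      exact ⟨fun _ => Ideal.zero_mem _, fun _ => rfl⟩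
  · rw [(ha S).2 hS, Pi.single_zero]
    exact Submodule.zero_mem _

/-- The terms of fixed homological degree of the complexes `K^{(n)}`, `n ≥ 0`, as a
`J`-filtration. -/
def koszulTermFiltration (d : ℕ) (hF : IsAdmissible I F) {J : Ideal R} (hJ : J ≤ F 1) (i : ℕ) :
    J.Filtration (Finset (Fin d) → R) where
  N n := koszulTerm d F n i
  mono n := koszulTerm_antitone hF i (by simp)
  smul_le n := by
    rw [Nat.cast_succ]
    exact smul_koszulTerm_le hF hJ n i

theorem koszulTermFiltration_stable (d : ℕ) (hF : IsAdmissible I F) {J : Ideal R}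
    (hJ : IsReduction F J) (i : ℕ) : (koszulTermFiltration d hF hJ.1 i).Stable := by
  obtain ⟨n₀, h⟩ := hJ.2
  refine ⟨(n₀ + i).toNat, fun n hn => ?_⟩
  change J • koszulTerm d F n i = koszulTerm d F (n + 1 : ℕ) i
  rw [Nat.cast_succ]
  exact (smul_koszulTerm_le hF hJ.1 n i).antisymm (koszulTerm_succ_le_smul (h _ (by omega)))

/-- By the Artin–Rees lemma the cycles satisfy `Z_{n+1} = J Z_n` for large `n`, and the Koszul
homotopy puts `J Z_n` into the boundaries. -/
theorem exists_koszulCycles_le_koszulBoundaries [IsNoetherianRing R] (hF : IsAdmissible I F)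
    {x : Fin d → R} (hx : IsReduction F (Ideal.span (Set.range x))) (i : ℕ) :
    ∃ n₀ : ℕ, ∀ n ≥ n₀, koszulCycles x F n i ≤ koszulBoundaries x F n i := by
  obtain ⟨n₀, h⟩ := (koszulTermFiltration_stable d hF hx i).inter_right
    (Ideal.trivialFiltration _ (LinearMap.ker (koszulDiff x)))
  refine ⟨n₀ + 1, fun n hn => ?_⟩
  obtain ⟨n, rfl⟩ : ∃ m, n = m + 1 := ⟨n - 1, by omega⟩
  have h1 : Ideal.span (Set.range x) • koszulCycles x F n i = koszulCycles x F (n + 1 : ℕ) i :=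
    h n (by omega)
  rw [← h1, Nat.cast_succ]
  exact span_smul_koszulCycles_le x F n i

theorem exists_eulerChar_eq_zero [IsNoetherianRing R] (hF : IsAdmissible I F)
    {x : Fin d → R} (hx : IsReduction F (Ideal.span (Set.range x))) :
    ∃ n₀ : ℕ, ∀ n : ℕ, n₀ ≤ n → eulerChar x F n = 0 := by
  choose n₀ h using exists_koszulCycles_le_koszulBoundaries hF hx
  refine ⟨(Finset.range (d + 1)).sup n₀, fun n hn => Finset.sum_eq_zero fun i hi => ?_⟩
  have hle := h i n ((Finset.le_sup hi).trans hn)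
  have : Subsingleton (koszulHomology x F n i) := by
    rw [Submodule.Quotient.subsingleton_iff, Submodule.submoduleOf_eq_top]
    exact hle
  rw [Module.length_eq_zero, ENat.toNat_zero, Nat.cast_zero, mul_zero]

/-! ### Comparison of the Euler characteristics -/

theorem koszulTerm_zero_le_ker (x : Fin d → R) (n : ℤ) :
    koszulTerm d F n 0 ≤ LinearMap.ker (koszulDiff x) := by
  intro a ha
  funext T
  refine Finset.sum_eq_zero fun j _ => ?_
  rw [(ha (insert j T)).2 (Finset.insert_nonempty j T).card_ne_zero, mul_zero]

theorem koszulBoundaries_top_eq_bot (x : Fin d → R) (n : ℤ) : koszulBoundaries x F n d = ⊥ := by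
  have : koszulTerm d F n (d + 1) = ⊥ := by
    refine (Submodule.eq_bot_iff _).2 fun a ha => funext fun S => (ha S).2 ?_
    have := S.card_le_univ
    rw [Fintype.card_fin] at this
    omega
  rw [koszulBoundaries, this, Submodule.map_bot]

/-- Euler–Poincaré principle for the quotient complex `K^{(m)} / K^{(n)}`, `m ≤ n`. -/
theorem eulerChar_sub_eulerChar (hF : IsAdmissible I F) {x : Fin d → R} (hx : ∀ j, x j ∈ F 1)
    (hH : ∀ n i, Module.length R (koszulHomology x F n i) ≠ ⊤) {m n : ℤ} (hmn : m ≤ n)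
    (hT : ∀ i, relLength (koszulTerm d F n i) (koszulTerm d F m i) ≠ ⊤) :
    eulerChar x F m - eulerChar x F n = ∑ i ∈ Finset.range (d + 1),
      (-1) ^ i * ((relLength (koszulTerm d F n i) (koszulTerm d F m i)).toNat : ℤ) := by
  set t : ℕ → ℕ∞ := fun i => relLength (koszulTerm d F n i) (koszulTerm d F m i) with ht
  set a : ℕ → ℕ∞ := fun i => relLength (koszulCycles x F n i) (koszulCycles x F m i) with ha
  set b : ℕ → ℕ∞ := fun i =>
    relLength (koszulBoundaries x F n i) (koszulBoundaries x F m i) with hb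
  have hZ := fun i => koszulCycles_antitone hF x i hmn
  have hB := fun i => koszulBoundaries_antitone hF x i hmn
  have hBZ := fun n i => koszulBoundaries_le_koszulCycles hF hx n i
  have t_zero : t 0 = a 0 := by
    simp only [ht, ha, koszulCycles]
    rw [inf_eq_left.2 (koszulTerm_zero_le_ker x n), inf_eq_left.2 (koszulTerm_zero_le_ker x m)]
  have t_succ : ∀ i, t (i + 1) = a (i + 1) + b i := fun i =>
    relLength_eq_ker_add_map (koszulDiff x) (koszulTerm_antitone hF (i + 1) hmn)
  have b_top : b d = 0 := by
    simp only [hb, koszulBoundaries_top_eq_bot]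
    exact Module.length_eq_zero
  have a_fin : ∀ i, a i ≠ ⊤ := by
    rintro (_ | i)
    · exact t_zero ▸ hT 0
    · exact ne_top_of_le_ne_top (hT (i + 1)) (le_self_add.trans (t_succ i).ge)
  have b_fin : ∀ i, b i ≠ ⊤ := fun i =>
    ne_top_of_le_ne_top (hT (i + 1)) (le_add_self.trans (t_succ i).ge)
  have h_sub : ∀ i, ((Module.length R (koszulHomology x F m i)).toNat : ℤ) -
      (Module.length R (koszulHomology x F n i)).toNat = (a i).toNat - (b i).toNat := by
    intro i
    -- both sides compute the length of `Z_i(K^{(m)}) / B_i(K^{(n)})`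
    have h1 : Module.length R (koszulHomology x F n i) + a i =
        b i + Module.length R (koszulHomology x F m i) :=
      (relLength_add (hBZ n i) (hZ i)).symm.trans (relLength_add (hB i) (hBZ m i))
    have h2 := congrArg ENat.toNat h1
    rw [ENat.toNat_add (hH n i) (a_fin i), ENat.toNat_add (b_fin i) (hH m i)] at h2
    omega
  have key : ∀ k, ∑ i ∈ Finset.range (k + 1), (-1 : ℤ) ^ i * ((a i).toNat - (b i).toNat) =
      ∑ i ∈ Finset.range (k + 1), (-1 : ℤ) ^ i * (t i).toNat - (-1) ^ k * (b k).toNat := by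
    intro k
    induction k with
    | zero => simp [t_zero]
    | succ k ih =>
      rw [Finset.sum_range_succ, ih, Finset.sum_range_succ _ (k + 1), t_succ,
        ENat.toNat_add (a_fin _) (b_fin _)]
      push_cast
      ring
  calc eulerChar x F m - eulerChar x F n
      = ∑ i ∈ Finset.range (d + 1), (-1 : ℤ) ^ i * ((a i).toNat - (b i).toNat) := by
        rw [eulerChar, eulerChar, ← Finset.sum_sub_distrib]
        refine Finset.sum_congr rfl fun i _ => ?_
        rw [← h_sub, mul_sub]
    _ = _ := by rw [key, b_top, ENat.toNat_zero, Nat.cast_zero, mul_zero, sub_zero]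

theorem relLength_koszulTerm_zero (hF : IsAdmissible I F) (n : ℤ) (i : ℕ) :
    relLength (koszulTerm d F n i) (koszulTerm d F 0 i) =
      (d.choose i : ℕ∞) * Module.length R (R ⧸ F (n - i)) := by
  classical
  let f : koszulTerm d F 0 i →ₗ[R] ({S : Finset (Fin d) // S.card = i} → R ⧸ F (n - i)) :=
    LinearMap.pi fun S =>
      (F (n - i)).mkQ ∘ₗ LinearMap.proj S.1 ∘ₗ (koszulTerm d F 0 i).subtype
  have hf : Function.Surjective f := by
    intro y
    choose z hz using fun S => (F (n - i)).mkQ_surjective (y S)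
    refine ⟨⟨fun S => if h : S.card = i then z ⟨S, h⟩ else 0, fun S => ⟨fun _ => ?_, fun h => ?_⟩⟩,
      ?_⟩
    · rw [hF.eq_top (by omega)]; trivial
    · exact dif_neg h
    · funext S
      rw [← hz S]
      change (F (n - i)).mkQ (dite _ _ _) = _
      rw [dif_pos S.2]
  have hker : LinearMap.ker f = (koszulTerm d F n i).submoduleOf (koszulTerm d F 0 i) := by
    ext ⟨a, ha⟩
    constructor
    · intro h S
      refine ⟨fun hS => ?_, (ha S).2⟩
      exact (Submodule.Quotient.mk_eq_zero _).1 (congrFun h ⟨S, hS⟩)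
    · intro h
      funext S
      exact (Submodule.Quotient.mk_eq_zero _).2 ((h S.1).1 S.2)
  rw [relLength, ← hker, (f.quotKerEquivOfSurjective hf).length_eq, Module.length_pi]
  congr 1
  rw [ENat.card_eq_coe_fintype_card, Fintype.card_finset_len, Fintype.card_fin]

/-- The Euler characteristics measure how far the `d`-th difference of the Hilbert function is
from the constant `χ(K^{(0)})`. -/
theorem sum_choose_mul_hilbertFunction (hF : IsAdmissible I F)
    (hfin : ∀ n, Module.length R (R ⧸ F n) ≠ ⊤) {x : Fin d → R} (hx : ∀ j, x j ∈ F 1)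
    (hH : ∀ n i, Module.length R (koszulHomology x F n i) ≠ ⊤) {n : ℤ} (hn : 0 ≤ n) :
    ∑ i ∈ Finset.range (d + 1), (-1 : ℤ) ^ i * (d.choose i * hilbertFunction F (n - i)) =
      eulerChar x F 0 - eulerChar x F n := by
  have hT : ∀ i, relLength (koszulTerm d F n i) (koszulTerm d F 0 i) ≠ ⊤ := fun i => by
    rw [relLength_koszulTerm_zero hF]
    exact WithTop.mul_ne_top (ENat.natCast_ne_top _) (hfin _)
  rw [eulerChar_sub_eulerChar hF hx hH hn hT]
  refine Finset.sum_congr rfl fun i _ => ?_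
  rw [relLength_koszulTerm_zero hF, ENat.toNat_mul, ENat.toNat_natCast, Nat.cast_mul,
    hilbertFunction]

end Filtration

/-! ### Backward differences and Hilbert coefficients -/

section Difference

open Filter Polynomial

/-- The backward difference operator `f ↦ (n ↦ f n - f (n - 1))`. -/
def bwdDiff : Module.End ℚ (ℤ → ℚ) where
  toFun f n := f n - f (n - 1)
  map_add' f g := by funext n; simp only [Pi.add_apply]; ring
  map_smul' c f := by
    funext n; simp only [Pi.smul_apply, smul_eq_mul, RingHom.id_apply]; ring

theorem bwdDiff_apply (f : ℤ → ℚ) (n : ℤ) : bwdDiff f n = f n - f (n - 1) := rfl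

theorem bwdDiff_pow_apply (k : ℕ) (f : ℤ → ℚ) (n : ℤ) :
    (bwdDiff ^ k) f n = ∑ i ∈ Finset.range (k + 1), (-1) ^ i * (k.choose i * f (n - i)) := by
  let S : Module.End ℚ (ℤ → ℚ) := LinearMap.funLeft ℚ ℚ fun m => m - 1
  have hS : ∀ (i : ℕ) (n : ℤ), ((-S) ^ i) f n = (-1) ^ i * f (n - i) := by
    intro i
    induction i with
    | zero => intro n; simp
    | succ i ih =>
      intro n
      rw [pow_succ', Module.End.mul_apply]
      change -((-S) ^ i) f (n - 1) = _
      rw [ih, Nat.cast_succ, show n - 1 - (i : ℤ) = n - (i + 1) by ring]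
      ring
  have h : bwdDiff = -S + 1 := by
    refine LinearMap.ext fun g => funext fun m => ?_
    change g m - g (m - 1) = -g (m - 1) + g m
    ring
  rw [h, (Commute.one_right (-S)).add_pow, LinearMap.sum_apply, Finset.sum_apply]
  refine Finset.sum_congr rfl fun i _ => ?_
  rw [one_pow, mul_one, ← Nat.cast_comm, ← nsmul_eq_mul, LinearMap.smul_apply, Pi.smul_apply,
    nsmul_eq_mul, hS, mul_left_comm]

theorem bwdDiff_eventuallyEq {f g : ℤ → ℚ} (h : f =ᶠ[atTop] g) :
    bwdDiff f =ᶠ[atTop] bwdDiff g := by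
  have h' : ∀ᶠ n : ℤ in atTop, f (n - 1) = g (n - 1) :=
    (tendsto_atTop_add_const_right atTop (-1 : ℤ) tendsto_id).eventually h
  filter_upwards [h, h'] with n h1 h2
  rw [bwdDiff_apply, bwdDiff_apply, h1, h2]

theorem bwdDiff_pow_eventuallyEq {f g : ℤ → ℚ} (h : f =ᶠ[atTop] g) (k : ℕ) :
    (bwdDiff ^ k) f =ᶠ[atTop] (bwdDiff ^ k) g := by
  induction k with
  | zero => simpa using h
  | succ k ih =>
    rw [pow_succ']
    exact bwdDiff_eventuallyEq ih

theorem exists_eventually_eq_of_bwdDiff {f : ℤ → ℚ} (h : bwdDiff f =ᶠ[atTop] 0) :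
    ∃ c, ∀ᶠ n in atTop, f n = c := by
  obtain ⟨N, hN⟩ := eventually_atTop.1 h
  refine ⟨f N, eventually_atTop.2 ⟨N, fun n hn => ?_⟩⟩
  induction n, hn using Int.leInduction with
  | base => rfl
  | succ n hn ih =>
    have := hN (n + 1) (by omega)
    rw [bwdDiff_apply, add_sub_cancel_right, Pi.zero_apply, sub_eq_zero] at this
    rw [this, ih]

theorem binomPoly_zero : binomPoly 0 = 1 := by simp [binomPoly]

theorem binomPoly_one : binomPoly 1 = X := by simp [binomPoly]

theorem binomPoly_succ_eval_sub (m : ℕ) (y : ℚ) :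
    (binomPoly (m + 1)).eval y - (binomPoly (m + 1)).eval (y - 1) = (binomPoly m).eval y := by
  have h1 := ascPochhammer_succ_eval m y
  have h2 : (ascPochhammer ℚ (m + 1)).eval (y - 1) = (y - 1) * (ascPochhammer ℚ m).eval y := by
    simp [ascPochhammer_succ_left]
  have h3 : ((m.factorial : ℕ) : ℚ) ≠ 0 := by exact_mod_cast m.factorial_ne_zero
  have h4 : (m : ℚ) + 1 ≠ 0 := by positivity
  simp only [binomPoly, eval_mul, eval_C, h1, h2, Nat.factorial_succ, Nat.cast_mul, Nat.cast_succ]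
  field_simp
  ring

theorem exists_int_eq_binomPoly_eval (m : ℕ) (n : ℤ) :
    ∃ z : ℤ, (binomPoly m).eval (n : ℚ) = z := by
  refine ⟨Ring.multichoose n m, ?_⟩
  have h := Ring.factorial_nsmul_multichoose_eq_ascPochhammer n m
  rw [Polynomial.ascPochhammer_smeval_eq_eval, nsmul_eq_mul] at h
  have h3 : ((m.factorial : ℕ) : ℚ) ≠ 0 := by exact_mod_cast m.factorial_ne_zero
  rw [binomPoly, eval_mul, eval_C, inv_mul_eq_iff_eq_mul₀ h3,
    ← ascPochhammer_map (Int.castRingHom ℚ), eval_intCast_map, Int.cast_id, ← h]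
  simp

/-- The function `n ↦ ∑_i (-1)^i e_i binom(n + d - i - 1, d - i)` on the integers. -/
noncomputable def hilbertPolyFun (d : ℕ) (e : Fin (d + 1) → ℤ) (n : ℤ) : ℚ :=
  (polyOfCoefficients d e).eval (n : ℚ)

theorem hilbertPolyFun_zero (e : Fin 1 → ℤ) (n : ℤ) : hilbertPolyFun 0 e n = e 0 := by
  simp [hilbertPolyFun, polyOfCoefficients, binomPoly_zero]

theorem hilbertPolyFun_one (e : Fin 2 → ℤ) (n : ℤ) :
    hilbertPolyFun 1 e n = e 0 * n - e 1 := by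
  simp [hilbertPolyFun, polyOfCoefficients, binomPoly_zero, binomPoly_one, Fin.sum_univ_two]
  ring

theorem hilbertPolyFun_succ (d : ℕ) (e : Fin (d + 2) → ℤ) (n : ℤ) :
    hilbertPolyFun (d + 1) e n =
      ∑ i : Fin (d + 1), (-1) ^ (i : ℕ) * (e i.castSucc : ℚ) *
        (binomPoly (d - i + 1)).eval (n : ℚ) + (-1) ^ (d + 1) * e (Fin.last (d + 1)) := by
  simp only [hilbertPolyFun, polyOfCoefficients, eval_finsetSum, eval_mul, eval_C]
  rw [Fin.sum_univ_castSucc]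
  congr 1
  · refine Finset.sum_congr rfl fun i _ => ?_
    rw [Fin.val_castSucc, Nat.sub_add_comm i.is_le]
  · simp [binomPoly_zero]

theorem bwdDiff_hilbertPolyFun (d : ℕ) (e : Fin (d + 2) → ℤ) :
    bwdDiff (hilbertPolyFun (d + 1) e) = hilbertPolyFun d fun i => e i.castSucc := by
  funext n
  rw [bwdDiff_apply, hilbertPolyFun_succ, hilbertPolyFun_succ, add_sub_add_right_eq_sub,
    ← Finset.sum_sub_distrib]
  simp only [hilbertPolyFun, polyOfCoefficients, eval_finsetSum, eval_mul, eval_C, ← mul_sub,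
    Int.cast_sub, Int.cast_one, binomPoly_succ_eval_sub]

theorem bwdDiff_pow_hilbertPolyFun (d k : ℕ) (e : Fin (d + k + 1) → ℤ) :
    (bwdDiff ^ k) (hilbertPolyFun (d + k) e) =
      hilbertPolyFun d fun i => e (i.castLE (by omega)) := by
  induction k with
  | zero => rfl
  | succ k ih =>
    rw [pow_succ, Module.End.mul_apply]
    change (bwdDiff ^ k) (bwdDiff (hilbertPolyFun (d + k + 1) e)) = _
    rw [bwdDiff_hilbertPolyFun, ih]
    rfl

theorem eq_of_hilbertPolyFun_eventuallyEq {d : ℕ} {e e' : Fin (d + 1) → ℤ}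
    (h : hilbertPolyFun d e =ᶠ[atTop] hilbertPolyFun d e') : e = e' := by
  induction d with
  | zero =>
    obtain ⟨n, hn⟩ := h.exists
    rw [hilbertPolyFun_zero, hilbertPolyFun_zero, Int.cast_inj] at hn
    funext i
    rw [Fin.fin_one_eq_zero i, hn]
  | succ d ih =>
    have h1 := bwdDiff_eventuallyEq h
    rw [bwdDiff_hilbertPolyFun, bwdDiff_hilbertPolyFun] at h1
    have h2 := congrFun (ih h1)
    obtain ⟨n, hn⟩ := h.exists
    rw [hilbertPolyFun_succ, hilbertPolyFun_succ] at hn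
    simp only [h2, add_right_inj] at hn
    have h3 : e (Fin.last (d + 1)) = e' (Fin.last (d + 1)) := by
      exact_mod_cast mul_left_cancel₀ (pow_ne_zero _ (by norm_num)) hn
    funext i
    exact Fin.lastCases h3 h2 i

/-- A function with values in `ℤ` whose `d`-th difference is eventually constant is eventually
given by integers `e_0, …, e_d`. -/
theorem exists_eventuallyEq_hilbertPolyFun (d : ℕ) (g : ℤ → ℤ) (c : ℚ)
    (h : ∀ᶠ n in atTop, (bwdDiff ^ d) (fun n => (g n : ℚ)) n = c) :
    ∃ e : Fin (d + 1) → ℤ, (fun n => (g n : ℚ)) =ᶠ[atTop] hilbertPolyFun d e := by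
  induction d generalizing g with
  | zero =>
    obtain ⟨N, hN⟩ := h.exists
    refine ⟨fun _ => g N, ?_⟩
    filter_upwards [h] with n hn
    rw [hilbertPolyFun_zero]
    exact hn.trans hN.symm
  | succ d ih =>
    have hg : bwdDiff (fun n => (g n : ℚ)) = fun n => ((g n - g (n - 1) : ℤ) : ℚ) := by
      funext n
      rw [bwdDiff_apply, Int.cast_sub]
    rw [pow_succ] at h
    simp only [Module.End.mul_apply, hg] at h
    obtain ⟨e, he⟩ := ih _ h
    rw [← hg] at he
    -- it remains to find the constant of integration, which is an integer
    let q := hilbertPolyFun (d + 1) (Fin.snoc e 0)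
    have hq : bwdDiff q = hilbertPolyFun d e := by
      rw [bwdDiff_hilbertPolyFun]
      simp only [Fin.snoc_castSucc]
    obtain ⟨b, hb⟩ := exists_eventually_eq_of_bwdDiff (f := (fun n => (g n : ℚ)) - q) (by
      filter_upwards [he] with n hn
      rw [map_sub, hq, Pi.sub_apply, hn, sub_self, Pi.zero_apply])
    have hqz : ∀ n, ∃ z : ℤ, q n = z := by
      intro n
      choose z hz using fun i : Fin (d + 1) => exists_int_eq_binomPoly_eval (d - i + 1) n
      refine ⟨∑ i : Fin (d + 1), (-1) ^ (i : ℕ) * e i * z i, ?_⟩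
      simp only [q, hilbertPolyFun_succ, Fin.snoc_castSucc, Fin.snoc_last, hz]
      push_cast
      ring
    obtain ⟨N, hN⟩ := hb.exists
    obtain ⟨z, hz⟩ := hqz N
    refine ⟨Fin.snoc e ((-1) ^ (d + 1) * (g N - z)), ?_⟩
    filter_upwards [hb] with n hn
    rw [Pi.sub_apply] at hn hN
    have h1 : hilbertPolyFun (d + 1) (Fin.snoc e ((-1) ^ (d + 1) * (g N - z))) n = q n + b := by
      rw [← hN, hz]
      simp only [q, hilbertPolyFun_succ, Fin.snoc_castSucc, Fin.snoc_last]
      push_cast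
      rw [← mul_assoc, ← mul_pow]
      norm_num
    rw [h1, ← hn, add_sub_cancel]

/-- If the `(k+1)`-st difference of `g` is `c - χ` on `ℕ`, where `g` vanishes on the integers
`≤ 0` and `χ` vanishes for large `n`, then summation gives `e_1` as the sum of the values of
`χ`. -/
theorem hasSum_of_bwdDiff_pow {k : ℕ} {g χ : ℤ → ℤ} {c : ℤ} (hg : ∀ n ≤ 0, g n = 0)
    (hχ : ∀ n ≥ 0, (bwdDiff ^ (1 + k)) (fun n => (g n : ℚ)) n = c - χ n)
    (hχ0 : ∃ n₀ : ℕ, ∀ n : ℕ, n₀ ≤ n → χ n = 0) (e : Fin (1 + k + 1) → ℤ)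
    (he : (fun n => (g n : ℚ)) =ᶠ[atTop] hilbertPolyFun (1 + k) e) :
    HasSum (fun n : ℕ => χ (n + 1)) (e 1) := by
  set G : ℤ → ℚ := (bwdDiff ^ k) fun n => (g n : ℚ) with hG
  have hdiff : ∀ n ≥ 0, G n - G (n - 1) = c - χ n := fun n hn => by
    rw [← hχ n hn, pow_add, pow_one]
    rfl
  have hG0 : G 0 = 0 := by
    rw [hG, bwdDiff_pow_apply]
    refine Finset.sum_eq_zero fun i _ => ?_
    rw [hg _ (by omega), Int.cast_zero, mul_zero, mul_zero]
  have hGe : ∀ᶠ n in atTop, G n = e 0 * n - e 1 := by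
    filter_upwards [bwdDiff_pow_eventuallyEq he k] with n hn
    rw [hG, hn, bwdDiff_pow_hilbertPolyFun, hilbertPolyFun_one]
    congr 2
    exact congrArg e (Fin.ext (Nat.mod_eq_of_lt (by omega)).symm)
  obtain ⟨n₁, hn₁⟩ := eventually_atTop.1 hGe
  obtain ⟨n₀, hn₀⟩ := hχ0
  obtain ⟨N, hN₀, hN₁⟩ : ∃ N : ℕ, n₀ ≤ N ∧ n₁ ≤ N := ⟨max n₀ n₁.toNat, by omega, by omega⟩
  have hc : (c : ℚ) = e 0 := by
    have h := hdiff (N + 1) (by omega)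
    rw [← Nat.cast_succ, hn₀ (N + 1) (by omega), hn₁ _ (by push_cast; omega),
      hn₁ _ (by push_cast; omega)] at h
    push_cast at h
    linarith
  have hsum : ∀ m : ℕ, ((∑ n ∈ Finset.range m, χ (n + 1) : ℤ) : ℚ) = m * c - G m := by
    intro m
    induction m with
    | zero => simp [hG0]
    | succ m ih =>
      have h := hdiff (m + 1) (by omega)
      rw [add_sub_cancel_right] at h
      rw [Finset.sum_range_succ, Int.cast_add, ih]
      push_cast
      linarith
  have hval : e 1 = ∑ n ∈ Finset.range N, χ (n + 1) := by
    have h := hsum N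
    rw [hn₁ _ hN₁, hc, Int.cast_natCast] at h
    have : ((∑ n ∈ Finset.range N, χ (n + 1) : ℤ) : ℚ) = e 1 := by rw [h]; ring
    exact_mod_cast this.symm
  rw [hval]
  refine hasSum_sum_of_ne_finset_zero fun n hn => ?_
  rw [Finset.mem_range, not_lt] at hn
  exact_mod_cast hn₀ (n + 1) (by omega)

end Difference
end ChernNumber

/-! ### The Chern number -/

open Filter in
theorem theorem1p1 {R : Type*} [CommRing R] [IsLocalRing R] [IsNoetherianRing R]
    (d : ℕ) (hd : 1 ≤ d) (hdim : ringKrullDim R = d)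
    (I : Ideal R) (hI : I.radical = IsLocalRing.maximalIdeal R)
    (F : ℤ → Ideal R) (hF : ChernNumber.IsAdmissible I F)
    (x : Fin d → R)
    (hx : ChernNumber.IsMinimalReduction F (Ideal.span (Set.range x))) :
    -- the lengths that enter the Hilbert function and the Euler characteristics are finite
    (∀ n : ℤ, Module.length R (R ⧸ F n) ≠ ⊤) ∧
    (∀ (n : ℤ) (i : ℕ), Module.length R (ChernNumber.koszulHomology x F n i) ≠ ⊤) ∧
    -- the Hilbert coefficients exist and are unique
    (∃! e : Fin (d + 1) → ℤ, ChernNumber.IsHilbertCoefficients d F e) ∧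
    -- the Chern number is the sum over `n ≥ 1` of the Euler characteristics
    (∀ e : Fin (d + 1) → ℤ, ChernNumber.IsHilbertCoefficients d F e →
      HasSum (fun n : ℕ => ChernNumber.eulerChar x F ((n : ℤ) + 1)) (e 1)) := by
  open ChernNumber in
  have hred : IsReduction F (Ideal.span (Set.range x)) := hx.prop
  have hfin := hF.length_quotient_ne_top hI
  have hH := length_koszulHomology_ne_top hF hI hred
  have hdiff : ∀ n ≥ 0, (bwdDiff ^ d) (fun n => ((hilbertFunction F n : ℤ) : ℚ)) n =
      eulerChar x F 0 - eulerChar x F n := fun n hn => by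
    have h := sum_choose_mul_hilbertFunction hF hfin (mem_filtration_one hred) hH hn
    rw [bwdDiff_pow_apply]
    exact_mod_cast congrArg (Int.cast : ℤ → ℚ) h
  have hvan := exists_eulerChar_eq_zero hF hred
  have hcoeff : ∀ e : Fin (d + 1) → ℤ, IsHilbertCoefficients d F e ↔
      (fun n => ((hilbertFunction F n : ℤ) : ℚ)) =ᶠ[atTop] hilbertPolyFun d e := fun e => by
    simp only [Int.cast_natCast]
    exact eventually_atTop.symm
  refine ⟨hfin, hH, ?_, fun e he => ?_⟩
  · obtain ⟨n₀, hn₀⟩ := hvan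
    obtain ⟨e, he⟩ := exists_eventuallyEq_hilbertPolyFun d (fun n => hilbertFunction F n)
      (eulerChar x F 0) (eventually_atTop.2 ⟨n₀, fun n hn => by
        lift n to ℕ using by omega
        rw [hdiff n (by omega), hn₀ n (by omega), Int.cast_zero, sub_zero]⟩)
    refine ⟨e, (hcoeff e).2 he, fun e' he' => ?_⟩
    exact eq_of_hilbertPolyFun_eventuallyEq (((hcoeff e').1 he').symm.trans he)
  · obtain ⟨k, rfl⟩ := Nat.exists_eq_add_of_le hd
    exact hasSum_of_bwdDiff_pow (χ := eulerChar x F)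
      (fun n hn => by rw [hF.hilbertFunction_eq_zero hn, Nat.cast_zero]) hdiff hvan e
      ((hcoeff e).1 he)
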